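/- Let $\mathscr A$ be a unital Banach $^*$-algebra, that is, a complex unital Banach algebra with a conjugate linear involution $a\mapsto a^*$ satisfying $(ab)^*=b^*a^*$ (not assumed to be continuous), and let $f,g:\mathscr A\to\mathbb C$ be positive linear functionals, i.e. $f(a^*a)\ge 0$ and $g(a^*a)\ge0$ for all $a\in\mathscr A$. Inner products $(\cdot\,|\,\cdot)$ are linear in the first variable. Then the following holds. (1) $f$ and $g$ are representable: each of them is of the form $a\mapsto(\pi(a)\zeta\,|\,\zeta)$ for some $^*$-representation $\pi$ of $\mathscr A$ by bounded operators on a Hilbert space and some vector $\zeta$ of that space. (2) Let $\bar{\mathscr A}'$ be the Banach space of continuous conjugate linear functionals on $\mathscr A$, with pairing $\langle\varphi,a\rangle:=\varphi(a)$. The formulas $\langle Aa,b\rangle=f(b^*a)$ and $\langle Ba,b\rangle=g(b^*a)$ $(a,b\in\mathscr A)$ define bounded linear operators $A,B:\mathscr A\to\bar{\mathscr A}'$, which are positive: $\langle Aa,a\rangle\ge0$ and $\langle Ba,a\rangle\geq0$ for all $a$. (3) For all $a\in\mathscr A$, $$(f:g)(a)=\overline{\langle (A:B)1,a\rangle}.$$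 Here $f:g$ and $A:B$ are the following parallel sums. Let $(H_f,\pi_f,\zeta_f)$ and $(H_g,\pi_g,\zeta_g)$ be the GNS triples of $f$ and $g$, let $\pi=\pi_f\oplus\pi_g$, and let $Q$ be the orthogonal projection of $H_f\oplus H_g$ onto the orthogonal complement of the closure of $\{\pi_f(a)\zeta_f\oplus\pi_g(a)\zeta_g : a\in\mathscr A\}$. Then $(f:g)(a):=(\pi(a)Q(\zeta_f\oplus0)\,|\,Q(\zeta_f\oplus 0))$. Let $E$ be a complex Banach space with anti-dual $\bar E'$, let $j_E:E\to\bar E''$, $j_E(x)(\varphi)=\overline{\varphi(x)}$, be its embedding into the anti-bidual, and let $A,B:E\to\bar E'$ be bounded positive operators. Let $H_A$ be the Hilbert space completion of $\operatorname{ran}A$ with respect to the inner product $(Ax\,|\,Ay)_A:=\langle Ax,y\rangle$, let $J_A:H_A\to\bar E'$ be the continuous extension of $Ax\mapsto Ax$, and define $H_B,J_B$ in the same way. For $(h,k)\in H_A\times H_B$ put $\widetilde J_A(h,k)=J_Ah$ and $J(h,k)=J_Ah+J_Bk$. The adjoint $T^*:\bar E''\to H_A\times H_B$ of a bounded operator $T:H_A\times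 H_B\to\bar E'$ is determined by $(T^*\Phi\,|\,u)=\Phi(Tu)$ for $\Phi\in\bar E''$, $u\in H_A\times H_B$. Let $P$ be the orthogonal projection of $H_A\times H_B$ onto $(\operatorname{ran}(J^*\circ j_E))^\perp$. Then $A:B:=\widetilde J_A P\widetilde J_A^*\circ j_E$. -/

import Mathlib

open scoped ComplexOrder InnerProductSpace

universe u

noncomputable section

/-! ### Positive operators into the topological anti-dual and their parallel sum -/

/-- The topological anti-dual of `E`: continuous conjugate linear functionals `E → ℂ`, with the
operator norm. The pairing `⟨φ, x⟩` is `φ x`. -/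
abbrev AntiDual (E : Type u) [NormedAddCommGroup E] [NormedSpace ℂ E] : Type u := E →L⋆[ℂ] ℂ

/-- The canonical linear map `j_E : x ↦ x̂`, `x̂ φ = conj (φ x)`, of `E` into its anti-bidual. -/
def antiBidualEmbedding (E : Type u) [NormedAddCommGroup E] [NormedSpace ℂ E] :
    E →L[ℂ] AntiDual (AntiDual E) :=
  LinearMap.mkContinuous₂ (σ₁₃ := RingHom.id ℂ) (σ₂₃ := starRingEnd ℂ)
    { toFun := fun x =>
        { toFun := fun φ => starRingEnd ℂ (φ x)
          map_add' := fun φ ψ => by simp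
          map_smul' := fun c φ => by simp }
      map_add' := fun x y => by ext φ; simp
      map_smul' := fun c x => by ext φ; simp }
    1 (fun x φ => by simpa [mul_comm] using φ.le_opNorm x)

@[simp]
theorem antiBidualEmbedding_apply {E : Type u} [NormedAddCommGroup E] [NormedSpace ℂ E]
    (x : E) (φ : AntiDual E) : antiBidualEmbedding E x φ = starRingEnd ℂ (φ x) := rfl

/-- The adjoint `J^*` of a bounded operator `J` from a Hilbert space `H` to the anti-dual of `E`,
acting from the anti-bidual of `E` to `H`: it is determined by `⟪h, J^* Φ⟫ = Φ (J h)`, where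
`⟪·, ·⟫` is conjugate linear in the first variable. -/
def antiAdjoint {E H : Type u} [NormedAddCommGroup E] [NormedSpace ℂ E]
    [NormedAddCommGroup H] [InnerProductSpace ℂ H] [CompleteSpace H] (J : H →L[ℂ] AntiDual E) :
    AntiDual (AntiDual E) →L[ℂ] H :=
  LinearMap.mkContinuous
    { toFun := fun Φ => (InnerProductSpace.toDual ℂ H).symm
        (((starL ℂ : ℂ ≃L⋆[ℂ] ℂ) : ℂ →L⋆[ℂ] ℂ).comp (Φ.comp J))
      map_add' := fun Φ Ψ => by
        rw [← map_add]; congr 1; ext h; simp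
      map_smul' := fun c Φ => by
        apply (InnerProductSpace.toDual ℂ H).injective
        ext h; simp [inner_smul_left] }
    ‖J‖ (fun Φ => by
      simp only [LinearMap.coe_mk, AddHom.coe_mk, LinearIsometryEquiv.norm_map]
      refine ContinuousLinearMap.opNorm_le_bound _ (by positivity) fun h => ?_
      have h1 := Φ.le_opNorm (J h)
      have h2 := mul_le_mul_of_nonneg_left (J.le_opNorm h) (norm_nonneg Φ)
      simp only [ContinuousLinearMap.comp_apply, ContinuousLinearEquiv.coe_coe, starL_apply,
        norm_star]
      linarith)

theorem inner_antiAdjoint {E H : Type u} [NormedAddCommGroup E] [NormedSpace ℂ E]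
    [NormedAddCommGroup H] [InnerProductSpace ℂ H] [CompleteSpace H] (J : H →L[ℂ] AntiDual E)
    (Φ : AntiDual (AntiDual E)) (h : H) : ⟪h, antiAdjoint J Φ⟫_ℂ = Φ (J h) := by
  rw [← inner_conj_symm]
  simp [antiAdjoint]

/-- The orthogonal projection of a Hilbert space onto the orthogonal complement of a subspace. -/
def projOrthogonal {H : Type u} [NormedAddCommGroup H] [InnerProductSpace ℂ H] [CompleteSpace H]
    (K : Submodule ℂ H) : H →L[ℂ] H := Kᗮ.starProjection

theorem inner_projOrthogonal_self_nonneg {H : Type u} [NormedAddCommGroup H]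
    [InnerProductSpace ℂ H] [CompleteSpace H] (K : Submodule ℂ H) (w : H) :
    0 ≤ ⟪projOrthogonal K w, w⟫_ℂ := by
  unfold projOrthogonal
  have h3 : Kᗮ.starProjection (Kᗮ.starProjection w) = Kᗮ.starProjection w :=
    Submodule.starProjection_eq_self_iff.mpr (Submodule.starProjection_apply_mem _ _)
  rw [← h3, Submodule.inner_starProjection_left_eq_right, inner_self_eq_norm_sq_to_K]
  simp

/-- A positive operator: a bounded linear operator `A` of `E` into its anti-dual such that
`⟨A x, x⟩ ≥ 0` for all `x`. -/
structure PositiveOperator (E : Type u) [NormedAddCommGroup E] [NormedSpace ℂ E] where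
  toCLM : E →L[ℂ] AntiDual E
  nonneg' : ∀ x, 0 ≤ toCLM x x

namespace PositiveOperator

variable {E : Type u} [NormedAddCommGroup E] [NormedSpace ℂ E]

theorem symm (A : PositiveOperator E) (x y : E) :
    starRingEnd ℂ (A.toCLM x y) = A.toCLM y x := by
  have him : ∀ z, (A.toCLM z z).im = 0 := fun z => (Complex.nonneg_iff.mp (A.nonneg' z)).2.symm
  have hx := him x
  have hy := him y
  have h1 := him (x + y)
  have h2 := him (x + Complex.I • y)
  simp [hx, hy] at h1 h2
  apply Complex.ext <;> simp <;> linarith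

/-- The range of `A` as a bare vector space; it does not carry the norm of the anti-dual. -/
def Ran (A : PositiveOperator E) : Type u := LinearMap.range A.toCLM.toLinearMap

instance (A : PositiveOperator E) : AddCommGroup A.Ran :=
  inferInstanceAs (AddCommGroup (LinearMap.range A.toCLM.toLinearMap))

instance (A : PositiveOperator E) : Module ℂ A.Ran :=
  inferInstanceAs (Module ℂ (LinearMap.range A.toCLM.toLinearMap))

/-- The linear map `ran A → E'`, `A x ↦ A x`. -/
def ranSubtype (A : PositiveOperator E) : A.Ran →ₗ[ℂ] AntiDual E :=
  (LinearMap.range A.toCLM.toLinearMap).subtype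

/-- `A` as a map onto its range. -/
def toRan (A : PositiveOperator E) : E →ₗ[ℂ] A.Ran := A.toCLM.toLinearMap.rangeRestrict

/-- Some `x` with `A x = u`. -/
def preimage (A : PositiveOperator E) (u : A.Ran) : E := Classical.choose u.2

theorem toCLM_preimage (A : PositiveOperator E) (u : A.Ran) :
    A.toCLM (A.preimage u) = A.ranSubtype u := Classical.choose_spec u.2

theorem ranSubtype_toRan (A : PositiveOperator E) (x : E) :
    A.ranSubtype (A.toRan x) = A.toCLM x := rfl

theorem ranSubtype_preimage (A : PositiveOperator E) (u : A.Ran) (y : E) :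
    A.ranSubtype u y = starRingEnd ℂ (A.toCLM y (A.preimage u)) := by
  rw [A.symm, toCLM_preimage]

/-- The inner product `(A x | A y)_A = ⟨A x, y⟩` of `ran A`. As Mathlib's inner products are
conjugate linear in the first variable, it reads `⟪A y, A x⟫ = ⟨A x, y⟩`. -/
abbrev ranCore (A : PositiveOperator E) : PreInnerProductSpace.Core ℂ A.Ran where
  inner u v := A.ranSubtype v (A.preimage u)
  conj_inner_symm u v := by
    rw [← A.toCLM_preimage u, A.symm, toCLM_preimage]
  re_inner_nonneg u := by
    have := A.nonneg' (A.preimage u)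
    rw [toCLM_preimage] at this
    exact (Complex.nonneg_iff.mp this).1
  add_left u v w := by
    rw [← A.toCLM_preimage w, ← A.symm, toCLM_preimage, map_add, ← A.symm, toCLM_preimage,
      ← A.symm _ (A.preimage w), toCLM_preimage]
    simp
  smul_left u v r := by
    rw [← A.toCLM_preimage v, ← A.symm, toCLM_preimage, map_smul, ← A.symm, toCLM_preimage]
    simp

instance (A : PositiveOperator E) : SeminormedAddCommGroup A.Ran :=
  InnerProductSpace.Core.toSeminormedAddCommGroup (c := A.ranCore)

instance (A : PositiveOperator E) : InnerProductSpace ℂ A.Ran :=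
  InnerProductSpace.ofCore A.ranCore

theorem inner_toRan (A : PositiveOperator E) (x : E) (v : A.Ran) :
    ⟪A.toRan x, v⟫_ℂ = A.ranSubtype v x := by
  change A.ranSubtype v (A.preimage (A.toRan x)) = _
  rw [← A.toCLM_preimage v, ← A.symm, toCLM_preimage, ← A.symm, ranSubtype_toRan]

/-- The Hilbert space `H_A`: the completion of `ran A`. -/
abbrev HilbertSpace (A : PositiveOperator E) : Type u := UniformSpace.Completion A.Ran

theorem norm_ranSubtype_le (A : PositiveOperator E) (v : A.Ran) :
    ‖A.ranSubtype v‖ ≤ √‖A.toCLM‖ * ‖v‖ := by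
  refine ContinuousLinearMap.opNorm_le_bound _ (by positivity) fun x => ?_
  have h1 : ‖A.toRan x‖ ≤ √‖A.toCLM‖ * ‖x‖ := by
    rw [← sq_le_sq₀ (norm_nonneg _) (by positivity), mul_pow,
      Real.sq_sqrt (norm_nonneg A.toCLM), ← inner_self_eq_norm_sq (𝕜 := ℂ), inner_toRan, ranSubtype_toRan]
    calc _ ≤ ‖A.toCLM x x‖ := RCLike.re_le_norm _
      _ ≤ ‖A.toCLM x‖ * ‖x‖ := (A.toCLM x).le_opNorm x
      _ ≤ (‖A.toCLM‖ * ‖x‖) * ‖x‖ := by gcongr; exact A.toCLM.le_opNorm x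
      _ = _ := by ring
  rw [← inner_toRan]
  calc _ ≤ ‖A.toRan x‖ * ‖v‖ := norm_inner_le_norm _ _
    _ ≤ (√‖A.toCLM‖ * ‖x‖) * ‖v‖ := by gcongr
    _ = _ := by ring

/-- The canonical operator `J_A : H_A → E'`, the continuous extension of `A x ↦ A x`. -/
def embedding (A : PositiveOperator E) : A.HilbertSpace →L[ℂ] AntiDual E :=
  (A.ranSubtype.mkContinuous (√‖A.toCLM‖) A.norm_ranSubtype_le).fromCompletion

/-- The Hilbert space `H_A × H_B` (with the `ℓ²` norm). -/
abbrev ProdSpace (A B : PositiveOperator E) : Type u :=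
  WithLp 2 (A.HilbertSpace × B.HilbertSpace)

/-- The operator `J̃_A : H_A × H_B → E'`, `(A x, B y) ↦ A x`. -/
def embeddingLeft (A B : PositiveOperator E) : ProdSpace A B →L[ℂ] AntiDual E :=
  A.embedding.comp (WithLp.fstL 2 ℂ A.HilbertSpace B.HilbertSpace)

/-- The operator `J̃_B : H_A × H_B → E'`, `(A x, B y) ↦ B y`. -/
def embeddingRight (A B : PositiveOperator E) : ProdSpace A B →L[ℂ] AntiDual E :=
  B.embedding.comp (WithLp.sndL 2 ℂ A.HilbertSpace B.HilbertSpace)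

/-- The operator `J : H_A × H_B → E'`, `(A x, B y) ↦ A x + B y`. -/
def embeddingSum (A B : PositiveOperator E) : ProdSpace A B →L[ℂ] AntiDual E :=
  embeddingLeft A B + embeddingRight A B

/-- The orthogonal projection `P` of `H_A × H_B` onto `(ran (J^* ∘ j_E))ᗮ`. -/
def proj (A B : PositiveOperator E) : ProdSpace A B →L[ℂ] ProdSpace A B :=
  projOrthogonal (LinearMap.range
    ((antiAdjoint (embeddingSum A B)).comp (antiBidualEmbedding E)).toLinearMap)

/-- The parallel sum `A : B = J̃_A P J̃_A^* ∘ j_E` of positive operators. -/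
def parallelSum (A B : PositiveOperator E) : PositiveOperator E where
  toCLM := (embeddingLeft A B).comp ((proj A B).comp
    ((antiAdjoint (embeddingLeft A B)).comp (antiBidualEmbedding E)))
  nonneg' x := by
    set w := antiAdjoint (embeddingLeft A B) (antiBidualEmbedding E x) with hw
    have h1 : starRingEnd ℂ (embeddingLeft A B (proj A B w) x) = ⟪proj A B w, w⟫_ℂ := by
      rw [hw, inner_antiAdjoint, antiBidualEmbedding_apply]
    have h2 : 0 ≤ ⟪proj A B w, w⟫_ℂ := inner_projOrthogonal_self_nonneg _ w
    change 0 ≤ embeddingLeft A B (proj A B w) x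
    rw [← h1] at h2
    simpa using star_nonneg_iff.mp h2

end PositiveOperator

/-! ### Representable functionals and their parallel sum -/

section Functionals

set_option linter.unusedSectionVars false

variable {𝒜 : Type u} [NonUnitalRing 𝒜] [StarRing 𝒜] [Module ℂ 𝒜] [IsScalarTower ℂ 𝒜 𝒜]
  [SMulCommClass ℂ 𝒜 𝒜] [StarModule ℂ 𝒜]

/-- A linear functional `f` on a `*`-algebra is positive if `f (a^* a) ≥ 0` for all `a`. -/
def IsPositiveFunctional (f : 𝒜 →ₗ[ℂ] ℂ) : Prop := ∀ a, 0 ≤ f (star a * a)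

/-- A linear functional `f` is representable if `f a = (π(a) ζ | ζ)` for some `*`-representation
`π` on a Hilbert space and some vector `ζ` of that space. -/
def IsRepresentable (f : 𝒜 →ₗ[ℂ] ℂ) : Prop :=
  ∃ (H : Type u) (_ : NormedAddCommGroup H) (_ : InnerProductSpace ℂ H) (_ : CompleteSpace H)
    (π : 𝒜 →⋆ₙₐ[ℂ] (H →L[ℂ] H)) (ζ : H), ∀ a, f a = ⟪ζ, π a ζ⟫_ℂ

variable (𝒜) in
/-- A representable (hence positive) functional. -/
structure RepresentableFunctional where
  toLinearMap : 𝒜 →ₗ[ℂ] ℂ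
  representable' : IsRepresentable toLinearMap

namespace RepresentableFunctional

variable (f g : RepresentableFunctional 𝒜)

theorem conj_apply_star_mul (a b : 𝒜) :
    starRingEnd ℂ (f.toLinearMap (star a * b)) = f.toLinearMap (star b * a) := by
  obtain ⟨H, _, _, _, π, ζ, h⟩ := f.representable'
  simp [h, map_mul, map_star, ContinuousLinearMap.star_eq_adjoint,
    ContinuousLinearMap.adjoint_inner_right]

theorem nonneg (a : 𝒜) : 0 ≤ f.toLinearMap (star a * a) := by
  obtain ⟨H, _, _, _, π, ζ, h⟩ := f.representable'
  simp only [h, map_mul, map_star, ContinuousLinearMap.star_eq_adjoint,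
    ContinuousLinearMap.mul_def, ContinuousLinearMap.comp_apply, ContinuousLinearMap.adjoint_inner_right]
  rw [inner_self_eq_norm_sq_to_K]
  simp

set_option linter.unusedVariables false in
/-- The vector space `𝒜`, to be equipped with the semi-inner product `(a | b)_f = f (b^* a)`. -/
def PreGNS (f : RepresentableFunctional 𝒜) : Type u := 𝒜

instance : AddCommGroup f.PreGNS := inferInstanceAs (AddCommGroup 𝒜)

instance : Module ℂ f.PreGNS := inferInstanceAs (Module ℂ 𝒜)

/-- The identity map `𝒜 → 𝒜`. -/
def toPreGNS : 𝒜 ≃ₗ[ℂ] f.PreGNS := LinearEquiv.refl ℂ _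

/-- The identity map `𝒜 → 𝒜`. -/
def ofPreGNS : f.PreGNS ≃ₗ[ℂ] 𝒜 := f.toPreGNS.symm

@[simp] theorem toPreGNS_ofPreGNS (x : f.PreGNS) : f.toPreGNS (f.ofPreGNS x) = x := rfl

@[simp] theorem ofPreGNS_toPreGNS (a : 𝒜) : f.ofPreGNS (f.toPreGNS a) = a := rfl

/-- The semi-inner product `(a | b)_f = f (b^* a)`; in Mathlib's order, `⟪b, a⟫ = f (b^* a)`. -/
abbrev gnsCore : PreInnerProductSpace.Core ℂ f.PreGNS where
  inner x y := f.toLinearMap (star (f.ofPreGNS x) * f.ofPreGNS y)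
  conj_inner_symm x y := f.conj_apply_star_mul _ _
  re_inner_nonneg x := (Complex.nonneg_iff.mp (f.nonneg (f.ofPreGNS x))).1
  add_left x y z := by simp [add_mul]
  smul_left x y r := by simp [smul_mul_assoc]

instance : SeminormedAddCommGroup f.PreGNS :=
  InnerProductSpace.Core.toSeminormedAddCommGroup (c := f.gnsCore)

instance : InnerProductSpace ℂ f.PreGNS := InnerProductSpace.ofCore f.gnsCore

theorem inner_preGNS (x y : f.PreGNS) :
    ⟪x, y⟫_ℂ = f.toLinearMap (star (f.ofPreGNS x) * f.ofPreGNS y) := rfl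

/-- The GNS Hilbert space `H_f`: the Hausdorff completion of `𝒜` with respect to `(· | ·)_f`. -/
abbrev GNS : Type u := UniformSpace.Completion f.PreGNS

theorem exists_bound_mul (a : 𝒜) :
    ∃ C : ℝ, ∀ x : f.PreGNS, ‖f.toPreGNS (a * f.ofPreGNS x)‖ ≤ C * ‖x‖ := by
  have key : ∀ (H : Type u) (_ : NormedAddCommGroup H) (_ : InnerProductSpace ℂ H)
      (_ : CompleteSpace H) (π : 𝒜 →⋆ₙₐ[ℂ] (H →L[ℂ] H)) (ζ : H),
      (∀ a, f.toLinearMap a = ⟪ζ, π a ζ⟫_ℂ) → ∀ x : f.PreGNS, ‖x‖ = ‖π (f.ofPreGNS x) ζ‖ := by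
    intro H _ _ _ π ζ h x
    rw [← sq_eq_sq₀ (norm_nonneg _) (norm_nonneg _), ← inner_self_eq_norm_sq (𝕜 := ℂ),
      ← inner_self_eq_norm_sq (𝕜 := ℂ), inner_preGNS, h]
    simp [map_mul, map_star, ContinuousLinearMap.star_eq_adjoint,
      ContinuousLinearMap.adjoint_inner_right]
  obtain ⟨H, i1, i2, i3, π, ζ, h⟩ := f.representable'
  refine ⟨‖π a‖, fun x => ?_⟩
  rw [key H i1 i2 i3 π ζ h, key H i1 i2 i3 π ζ h]
  simpa using (π a).le_opNorm (π (f.ofPreGNS x) ζ)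

/-- Left multiplication by `a` on `PreGNS`. -/
def leftMul (a : 𝒜) : f.PreGNS →L[ℂ] f.PreGNS :=
  (f.toPreGNS.toLinearMap ∘ₗ LinearMap.mulLeft ℂ a ∘ₗ
    f.ofPreGNS.toLinearMap).mkContinuousOfExistsBound (f.exists_bound_mul a)

@[simp]
theorem leftMul_apply (a : 𝒜) (x : f.PreGNS) :
    f.leftMul a x = f.toPreGNS (a * f.ofPreGNS x) := rfl

theorem completion_leftMul_smul (c : ℂ) (a : 𝒜) :
    (f.leftMul (c • a)).completion = c • (f.leftMul a).completion := by
  ext x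
  induction x using UniformSpace.Completion.induction_on with
  | hp =>
    exact isClosed_eq (f.leftMul (c • a)).completion.continuous
      (c • (f.leftMul a).completion).continuous
  | ih x => simp [smul_mul_assoc]

/-- The GNS representation `π_f`, determined by `π_f(a) [b] = [a b]`. -/
def gnsRep : 𝒜 →⋆ₙₐ[ℂ] (f.GNS →L[ℂ] f.GNS) where
  toFun a := (f.leftMul a).completion
  map_smul' c a := f.completion_leftMul_smul c a
  map_zero' := by simpa using f.completion_leftMul_smul 0 0
  map_add' a b := by
    ext x
    induction x using UniformSpace.Completion.induction_on with
    | hp => apply isClosed_eq <;> fun_prop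
    | ih x => simp [add_mul, UniformSpace.Completion.coe_add]
  map_mul' a b := by
    ext x
    induction x using UniformSpace.Completion.induction_on with
    | hp => apply isClosed_eq <;> fun_prop
    | ih x => simp [mul_assoc]
  map_star' a := by
    refine (ContinuousLinearMap.eq_adjoint_iff (f.leftMul (star a)).completion
      (f.leftMul a).completion).mpr ?_
    intro x y
    induction x, y using UniformSpace.Completion.induction_on₂ with
    | hp => apply isClosed_eq <;> fun_prop
    | ih x y => simp [mul_assoc, inner_preGNS]

theorem exists_bound_apply : ∃ C : ℝ, ∀ x : f.PreGNS, ‖f.toLinearMap (f.ofPreGNS x)‖ ≤ C * ‖x‖ := by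
  obtain ⟨H, i1, i2, i3, π, ζ, h⟩ := f.representable'
  refine ⟨‖ζ‖, fun x => ?_⟩
  have hx : ‖x‖ = ‖π (f.ofPreGNS x) ζ‖ := by
    rw [← sq_eq_sq₀ (norm_nonneg _) (norm_nonneg _), ← inner_self_eq_norm_sq (𝕜 := ℂ),
      ← inner_self_eq_norm_sq (𝕜 := ℂ), inner_preGNS, h]
    simp [map_mul, map_star, ContinuousLinearMap.star_eq_adjoint,
      ContinuousLinearMap.adjoint_inner_right]
  rw [h, hx]
  exact norm_inner_le_norm _ _

/-- The functional `f`, continuous on `PreGNS`. -/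
def gnsFunctional : f.PreGNS →L[ℂ] ℂ :=
  (f.toLinearMap ∘ₗ f.ofPreGNS.toLinearMap).mkContinuousOfExistsBound f.exists_bound_apply

/-- The GNS cyclic vector `ζ_f ∈ H_f`: the vector representing `[a] ↦ f a`. -/
def gnsVector : f.GNS := (InnerProductSpace.toDual ℂ f.GNS).symm f.gnsFunctional.fromCompletion

theorem inner_gnsVector (a : 𝒜) :
    ⟪f.gnsVector, (f.toPreGNS a : f.GNS)⟫_ℂ = f.toLinearMap a := by
  simp [gnsVector]; rfl

theorem gnsRep_gnsVector (a : 𝒜) : f.gnsRep a f.gnsVector = (f.toPreGNS a : f.GNS) := by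
  refine ext_inner_right ℂ fun y => ?_
  induction y using UniformSpace.Completion.induction_on with
  | hp => apply isClosed_eq <;> fun_prop
  | ih y =>
    rw [← ContinuousLinearMap.adjoint_inner_right, ← ContinuousLinearMap.star_eq_adjoint,
      ← map_star, UniformSpace.Completion.inner_coe, inner_preGNS]
    change ⟪f.gnsVector, (f.leftMul (star a)).completion y⟫_ℂ = _
    rw [ContinuousLinearMap.completion_apply_coe, leftMul_apply, inner_gnsVector]
    rfl

theorem inner_gnsRep (a : 𝒜) :
    ⟪f.gnsVector, f.gnsRep a f.gnsVector⟫_ℂ = f.toLinearMap a := by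
  rw [gnsRep_gnsVector, inner_gnsVector]

/-- The Hilbert space direct sum `H_f ⊕ H_g`. -/
abbrev GNSSum : Type u := WithLp 2 (f.GNS × g.GNS)

/-- The operator `S ⊕ T` on a Hilbert space direct sum. -/
def directSumOp {H K : Type u} [NormedAddCommGroup H] [InnerProductSpace ℂ H]
    [NormedAddCommGroup K] [InnerProductSpace ℂ K] (S : H →L[ℂ] H) (T : K →L[ℂ] K) :
    WithLp 2 (H × K) →L[ℂ] WithLp 2 (H × K) :=
  ((WithLp.prodContinuousLinearEquiv 2 ℂ H K).symm : H × K →L[ℂ] WithLp 2 (H × K)).comp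
    ((S.prodMap T).comp
      (WithLp.prodContinuousLinearEquiv 2 ℂ H K : WithLp 2 (H × K) →L[ℂ] H × K))

@[simp]
theorem directSumOp_apply {H K : Type u} [NormedAddCommGroup H] [InnerProductSpace ℂ H]
    [NormedAddCommGroup K] [InnerProductSpace ℂ K] (S : H →L[ℂ] H) (T : K →L[ℂ] K)
    (x : WithLp 2 (H × K)) :
    directSumOp S T x = WithLp.toLp 2 (S x.fst, T x.snd) := rfl

/-- The direct sum `π = π_f ⊕ π_g` of the GNS representations. -/
def gnsRepSum : 𝒜 →⋆ₙₐ[ℂ] (GNSSum f g →L[ℂ] GNSSum f g) where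
  toFun a := directSumOp (f.gnsRep a) (g.gnsRep a)
  map_smul' c a := by ext x <;> simp [← WithLp.toLp_smul]
  map_zero' := by ext x <;> simp
  map_add' a b := by ext x <;> simp [← WithLp.toLp_add]
  map_mul' a b := by ext x <;> simp
  map_star' a := by
    refine (ContinuousLinearMap.eq_adjoint_iff _ _).mpr fun x y => ?_
    simp [map_star, ContinuousLinearMap.star_eq_adjoint, ContinuousLinearMap.adjoint_inner_left]

/-- The subspace `{π_f(a) ζ_f ⊕ π_g(a) ζ_g : a ∈ 𝒜}` of `H_f ⊕ H_g`. -/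
def gnsDiagonal : Submodule ℂ (GNSSum f g) where
  carrier := Set.range fun a : 𝒜 =>
    WithLp.toLp 2 (f.gnsRep a f.gnsVector, g.gnsRep a g.gnsVector)
  add_mem' := by
    rintro _ _ ⟨a, rfl⟩ ⟨b, rfl⟩
    exact ⟨a + b, by simp [← WithLp.toLp_add]⟩
  zero_mem' := ⟨0, by simp⟩
  smul_mem' := by
    rintro c _ ⟨a, rfl⟩
    exact ⟨c • a, by simp [← WithLp.toLp_smul]⟩

/-- The vector `P (ζ_f ⊕ 0)`, where `P` is the orthogonal projection onto the orthogonal complement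
of the closure of `{π_f(a) ζ_f ⊕ π_g(a) ζ_g : a ∈ 𝒜}`. -/
def parallelVector : GNSSum f g :=
  projOrthogonal (gnsDiagonal f g).topologicalClosure (WithLp.toLp 2 (f.gnsVector, 0))

/-- The parallel sum `f : g` of representable functionals:
`(f : g)(a) = (π(a) P(ζ_f ⊕ 0) | P(ζ_f ⊕ 0))`. -/
def parallelSum : RepresentableFunctional 𝒜 where
  toLinearMap :=
    { toFun := fun a => ⟪parallelVector f g, gnsRepSum f g a (parallelVector f g)⟫_ℂ
      map_add' := fun a b => by rw [map_add, add_apply, inner_add_right]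
      map_smul' := fun c a => by
        rw [map_smul, smul_apply, inner_smul_right]; rfl }
  representable' := ⟨GNSSum f g, inferInstance, inferInstance, inferInstance, gnsRepSum f g,
    parallelVector f g, fun _ => rfl⟩

end RepresentableFunctional

end Functionals

end

/-! Both parallel sums are the same Hilbert space computation. Since `(A a | A b)_A = f (b^* a) = (a
| b)_f`, the map `[a] ↦ A a` is isometric from `H_f` to `H_A`, and likewise for `g`; together these
give an isometry `W` of `H_f ⊕ H_g` into `H_A × H_B`. From `J^* (j_E a) = (A a, B a)` it follows
that `W` carries the diagonal `{π_f(a) ζ_f ⊕ π_g(a) ζ_g}` onto `ran (J^* ∘ j_E)`, and an isometry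
intertwines the projections onto the complements, surjective or not. Both sides of (3) then reduce
to the inner product of `Q(ζ_f ⊕ 0)` with `π(a)(ζ_f ⊕ 0)` (`parallelSum_eq_conj`).

The analytic work comes from the involution being possibly discontinuous. Left multiplications are
bounded for `(· | ·)_f` because `1 - c⁻¹ a^* a` has a self-adjoint square root for large `c` (Ford's
lemma), which yields the GNS representation. The operator `A` is bounded because a `*`-homomorphism
into a C⋆-algebra is automatically continuous (`StarAlgHom.exists_norm_map_le`); there a three
circles estimate for spectral radii provides a closed graph, to which the open mapping theorem
applies. -/

/-! ### Spectral radius, powers and the involution. -/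

section SpectralRadius

variable {A : Type*} [NormedRing A] [NormedAlgebra ℂ A] [CompleteSpace A]

/-- The spectral radius is at most the norm, also when `‖1‖ ≠ 1`. -/
theorem spectralRadius_le_nnnorm_of_complete (a : A) : spectralRadius ℂ a ≤ ‖a‖₊ := by
  refine le_of_tendsto (spectrum.pow_nnnorm_pow_one_div_tendsto_nhds_spectralRadius a) ?_
  -- Restricting to `n > 0` keeps `‖1‖` out of the submultiplicative bound.
  filter_upwards [Filter.eventually_gt_atTop 0] with n hn
  have hn' : (n : ℝ) ≠ 0 := by positivity
  calc ((‖a ^ n‖₊ : ENNReal)) ^ (1 / n : ℝ) ≤ ((‖a‖₊ : ENNReal) ^ n) ^ (1 / n : ℝ) := by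
        gcongr
        exact_mod_cast nnnorm_pow_le' a hn
    _ = ‖a‖₊ := by
        rw [← ENNReal.rpow_natCast, ← ENNReal.rpow_mul, mul_one_div_cancel hn', ENNReal.rpow_one]

theorem eventually_norm_pow_lt {a : A} {M : ℝ} (h : spectralRadius ℂ a < ENNReal.ofReal M) :
    ∀ᶠ n : ℕ in Filter.atTop, ‖a ^ n‖ < M ^ n := by
  have hM : 0 < M := ENNReal.ofReal_pos.mp (bot_le.trans_lt h)
  filter_upwards [(spectrum.pow_norm_pow_one_div_tendsto_nhds_spectralRadius a).eventually_lt_const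
    h, Filter.eventually_gt_atTop 0] with n hn hn0
  have hn' : (n : ℝ) ≠ 0 := by positivity
  have h1 := (ENNReal.ofReal_lt_ofReal_iff hM).mp hn
  have h2 := pow_lt_pow_left₀ h1 (by positivity) hn0.ne'
  rwa [← Real.rpow_natCast, ← Real.rpow_mul (norm_nonneg _), one_div_mul_cancel hn',
    Real.rpow_one] at h2

/-- The spectrum is merely conjugated by the involution. This controls `star a` where its norm is
not comparable with `‖a‖`. -/
theorem spectralRadius_star_eq {A : Type*} [NormedRing A] [NormedAlgebra ℂ A] [StarRing A]
    [StarModule ℂ A] (a : A) :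
    spectralRadius ℂ (star a) = spectralRadius ℂ a := by
  simp only [spectralRadius, spectrum.map_star]
  refine le_antisymm (iSup₂_le fun z hz => ?_) (iSup₂_le fun z hz => ?_)
  · simpa using le_iSup₂ (f := fun (k : ℂ) (_ : k ∈ spectrum ℂ a) => (‖k‖₊ : ENNReal)) (star z) hz
  · simpa using le_iSup₂ (f := fun (k : ℂ) (_ : k ∈ star (spectrum ℂ a)) => (‖k‖₊ : ENNReal))
      (star z) (by simpa using hz)

end SpectralRadius

/-! ### Ford's square root lemma. -/

section SquareRoot

variable {A : Type*} [NormedRing A]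

/-- The solution of `w = (h + w ^ 2) / 2` in the bicommutant of a small element `h`. -/
theorem exists_small_sub_sq_eq [NormedAlgebra ℂ A] [CompleteSpace A] {h : A} (hh : ‖h‖ ≤ 1 / 2) :
    ∃ w : A, ‖w‖ ≤ 1 / 2 ∧ (1 - w) * (1 - w) = 1 - h ∧
      ∀ y, Commute h y → Commute w y := by
  -- Banach's fixed point theorem for `T` on the closed set `s`. Keeping the bicommutant condition
  -- in `s` is what later makes `w` commute with `star w`.
  let T : A → A := fun w => (2⁻¹ : ℂ) • (h + w * w)
  let s : Set A := {w | ‖w‖ ≤ 1 / 2 ∧ ∀ y, Commute h y → Commute w y}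
  have hnorm : ∀ x : A, ‖(2⁻¹ : ℂ) • x‖ ≤ 2⁻¹ * ‖x‖ := fun x =>
    (norm_smul_le _ _).trans_eq (by norm_num)
  have hs : IsComplete s := by
    apply IsClosed.isComplete
    have : s = {w | ‖w‖ ≤ 1 / 2} ∩ ⋂ y, ⋂ (_ : Commute h y), {w | w * y = y * w} := by
      ext w; simp [s, Commute, SemiconjBy]
    rw [this]
    refine (isClosed_le (by fun_prop) (by fun_prop)).inter
      (isClosed_iInter fun y => isClosed_iInter fun _ => isClosed_eq (by fun_prop) (by fun_prop))
  have hmaps : Set.MapsTo T s s := by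
    rintro w ⟨hw, hc⟩
    refine ⟨(hnorm _).trans ?_, fun y hy => ((hy.add_left ((hc y hy).mul_left (hc y hy))).smul_left _)⟩
    have h1 := norm_add_le h (w * w)
    have h2 := norm_mul_le w w
    nlinarith [norm_nonneg w]
  have hcontr : ContractingWith (1 / 2) (hmaps.restrict T s s) := by
    refine ⟨by norm_num, LipschitzWith.of_dist_le_mul ?_⟩
    rintro ⟨v, hv, -⟩ ⟨w, hw, -⟩
    rw [Subtype.dist_eq, Subtype.dist_eq, dist_eq_norm, dist_eq_norm]
    change ‖T v - T w‖ ≤ _ * ‖v - w‖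
    -- As `‖v‖, ‖w‖ ≤ 1 / 2`, the Lipschitz constant is `2⁻¹ * (1 / 2 + 1 / 2) = 1 / 2`.
    have h0 : T v - T w = (2⁻¹ : ℂ) • (v * (v - w) + (v - w) * w) := by
      simp only [T, ← smul_sub]; congr 1; noncomm_ring
    rw [h0]
    refine (hnorm _).trans ?_
    have h1 := norm_add_le (v * (v - w)) ((v - w) * w)
    have h2 := norm_mul_le v (v - w)
    have h3 := norm_mul_le (v - w) w
    push_cast
    nlinarith [norm_nonneg (v - w)]
  obtain ⟨w, ⟨hw, hc⟩, hfix, -⟩ := hcontr.exists_fixedPoint' hs hmaps (x := 0)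
    ⟨by simp, fun y _ => Commute.zero_left y⟩ (edist_ne_top _ _)
  refine ⟨w, hw, ?_, hc⟩
  have h1 : (2⁻¹ : ℂ) • (h + w * w) = w := hfix
  have h2 : h + w * w = w + w := by
    rw [← two_smul ℂ w]
    nth_rewrite 3 [← h1]
    rw [smul_smul]; norm_num
  calc (1 - w) * (1 - w) = 1 - (w + w) + w * w := by noncomm_ring
    _ = 1 - h := by rw [← h2]; abel

/-- If `w` and `v` commute, `w` is small and the spectral radius of `v` is small, then `1 - w` and
`1 - v` can only have the same square if they agree. -/
theorem eq_of_one_sub_sq_eq [NormedAlgebra ℂ A] [CompleteSpace A] {v w : A} (hvw : Commute w v)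
    (hw : ‖w‖ ≤ 1 / 2) (hv : spectralRadius ℂ v ≤ ENNReal.ofReal (1 / 2))
    (h : (1 - w) * (1 - w) = (1 - v) * (1 - v)) : w = v := by
  set d := w - v with hd
  -- For commuting `v` and `w`, equality of the squares says `d * (2 - w - v) = 0`.
  have hdv : d * v = d * (2 - w) := by
    have h2 : w * v = v * w := hvw
    have h1 : d * (2 - w) - d * v = (1 - v) * (1 - v) - (1 - w) * (1 - w) + (v * w - w * v) := by
      rw [hd]; noncomm_ring
    rw [h, h2] at h1
    rw [← sub_eq_zero, ← neg_sub, h1]; simp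
  have hc : Commute (2 - w) v := (Commute.ofNat_left 2 v).sub_left hvw
  have hpow : ∀ n : ℕ, d * v ^ n = d * (2 - w) ^ n := by
    intro n
    induction n with
    | zero => simp
    | succ n ih =>
      rw [pow_succ, ← mul_assoc, ih, mul_assoc, (hc.pow_left n).eq, ← mul_assoc, hdv, mul_assoc,
        ← pow_succ']
  -- Right multiplication by `2 - w` expands norms by at least `2 - ‖w‖ ≥ 3 / 2`, whereas `d * v ^
  -- n` has norm at most `‖d‖` once `‖v ^ n‖ < 1`. Hence `d = 0`.
  have hlow : ∀ n : ℕ, (3 / 2 : ℝ) ^ n * ‖d‖ ≤ ‖d * (2 - w) ^ n‖ := by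
    intro n
    induction n with
    | zero => simp
    | succ n ih =>
      set e := d * (2 - w) ^ n with he
      have h1 : d * (2 - w) ^ (n + 1) = (2 : ℂ) • e - e * w := by
        rw [pow_succ, ← mul_assoc, ← he, mul_sub, two_smul, mul_two]
      rw [h1]
      have h2 := norm_sub_norm_le ((2 : ℂ) • e) (e * w)
      have h3 := norm_mul_le e w
      have h4 : ‖(2 : ℂ) • e‖ = 2 * ‖e‖ := by rw [norm_smul]; norm_num
      rw [pow_succ]
      nlinarith [norm_nonneg e]
  have hlt : spectralRadius ℂ v < ENNReal.ofReal 1 :=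
    hv.trans_lt ((ENNReal.ofReal_lt_ofReal_iff one_pos).mpr (by norm_num))
  obtain ⟨n, hn, hn1⟩ := ((eventually_norm_pow_lt hlt).and
    (Filter.eventually_gt_atTop 0)).exists
  have h1 := hlow n
  rw [← hpow] at h1
  have h2 := norm_mul_le d (v ^ n)
  have h3 : (1 : ℝ) < (3 / 2) ^ n := one_lt_pow₀ (by norm_num) hn1.ne'
  rw [one_pow] at hn
  have h4 : ‖d‖ = 0 := by nlinarith [norm_nonneg d]
  exact sub_eq_zero.mp (norm_eq_zero.mp h4)

/-- Ford's square root lemma, for small self-adjoint elements. The involution need not be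
continuous. -/
theorem IsSelfAdjoint.exists_sq_eq_one_sub [NormedAlgebra ℂ A] [CompleteSpace A] [StarRing A]
    [StarModule ℂ A] {h : A} (hsa : IsSelfAdjoint h) (hh : ‖h‖ ≤ 1 / 2) :
    ∃ u : A, IsSelfAdjoint u ∧ u * u = 1 - h := by
  obtain ⟨w, hw, hsq, hc⟩ := exists_small_sub_sq_eq hh
  have hhw : Commute h (star w) := by
    have := (hc h (Commute.refl h)).star_star
    rw [hsa.star_eq] at this
    exact this.symm
  -- `star w` is a second solution, since `h` is self-adjoint. Only its spectral radius is known to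
  -- be small, which suffices for uniqueness.
  have key : w = star w := by
    refine eq_of_one_sub_sq_eq (hc _ hhw) hw ?_ ?_
    · rw [spectralRadius_star_eq]
      refine (spectralRadius_le_nnnorm_of_complete w).trans ?_
      rw [← ENNReal.ofReal_coe_nnreal]
      exact ENNReal.ofReal_le_ofReal hw
    · have := congrArg star hsq
      rw [star_mul, star_sub, star_sub, star_one, hsa.star_eq] at this
      rw [hsq, this]
  exact ⟨1 - w, by rw [isSelfAdjoint_iff, star_sub, star_one, ← key], hsq⟩

end SquareRoot

/-! ### GNS representation of a positive functional. -/

noncomputable section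

namespace IsPositiveFunctional

section Algebraic

set_option linter.unusedSectionVars false

variable {𝒜 : Type u} [Ring 𝒜] [StarRing 𝒜] [Algebra ℂ 𝒜] [StarModule ℂ 𝒜] {f : 𝒜 →ₗ[ℂ] ℂ}

/-- Polarization: `f (z^* z)` is real at `a`, `b`, `a + b` and `a + i b`. -/
theorem conj_apply_star_mul (hf : IsPositiveFunctional f) (a b : 𝒜) :
    starRingEnd ℂ (f (star a * b)) = f (star b * a) := by
  have him : ∀ z, (f (star z * z)).im = 0 := fun z => (Complex.nonneg_iff.mp (hf z)).2.symm
  have ha := him a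
  have hb := him b
  have h1 := him (a + b)
  have h2 := him (a + Complex.I • b)
  simp [add_mul, mul_add, ha, hb] at h1 h2
  apply Complex.ext <;> simp <;> linarith

set_option linter.unusedVariables false in
/-- The vector space `𝒜`, to be equipped with the semi-inner product `(a | b) = f (b^* a)`. -/
def PreHilbert (hf : IsPositiveFunctional f) : Type u := 𝒜

variable (hf : IsPositiveFunctional f)

instance : AddCommGroup hf.PreHilbert := inferInstanceAs (AddCommGroup 𝒜)

instance : Module ℂ hf.PreHilbert := inferInstanceAs (Module ℂ 𝒜)

/-- The identity map `𝒜 → 𝒜`. -/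
def toPreHilbert : 𝒜 ≃ₗ[ℂ] hf.PreHilbert := LinearEquiv.refl ℂ _

/-- The identity map `𝒜 → 𝒜`. -/
def ofPreHilbert : hf.PreHilbert ≃ₗ[ℂ] 𝒜 := hf.toPreHilbert.symm

@[simp] theorem ofPreHilbert_toPreHilbert (a : 𝒜) : hf.ofPreHilbert (hf.toPreHilbert a) = a := rfl

@[simp] theorem toPreHilbert_ofPreHilbert (x : hf.PreHilbert) :
    hf.toPreHilbert (hf.ofPreHilbert x) = x := rfl

/-- The semi-inner product `(a | b) = f (b^* a)`; in Mathlib's order, `⟪b, a⟫ = f (b^* a)`. -/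
abbrev preHilbertCore : PreInnerProductSpace.Core ℂ hf.PreHilbert where
  inner x y := f (star (hf.ofPreHilbert x) * hf.ofPreHilbert y)
  conj_inner_symm x y := hf.conj_apply_star_mul _ _
  re_inner_nonneg x := (Complex.nonneg_iff.mp (hf (hf.ofPreHilbert x))).1
  add_left x y z := by simp [add_mul]
  smul_left x y r := by simp

instance : SeminormedAddCommGroup hf.PreHilbert :=
  InnerProductSpace.Core.toSeminormedAddCommGroup (c := hf.preHilbertCore)

instance : InnerProductSpace ℂ hf.PreHilbert := InnerProductSpace.ofCore hf.preHilbertCore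

theorem inner_preHilbert (x y : hf.PreHilbert) :
    ⟪x, y⟫_ℂ = f (star (hf.ofPreHilbert x) * hf.ofPreHilbert y) := rfl

theorem norm_sq_preHilbert (x : hf.PreHilbert) :
    ‖x‖ ^ 2 = (f (star (hf.ofPreHilbert x) * hf.ofPreHilbert x)).re := by
  rw [← inner_self_eq_norm_sq (𝕜 := ℂ), inner_preHilbert]; rfl

end Algebraic

variable {𝒜 : Type u} [NormedRing 𝒜] [NormedAlgebra ℂ 𝒜] [CompleteSpace 𝒜] [StarRing 𝒜]
  [StarModule ℂ 𝒜] {f : 𝒜 →ₗ[ℂ] ℂ}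

/-- With `u` self-adjoint and `u² = 1 - c⁻¹ a^* a`, positivity at `u x` reads `0 ≤ f (x^* x) - c⁻¹ f
((a x)^* (a x))`. The constant makes `‖c⁻¹ a^* a‖ ≤ 1 / 2`, and the `+ 1` keeps `c` positive. -/
theorem conj_mul_re_le (hf : IsPositiveFunctional f) (a x : 𝒜) :
    (f (star (a * x) * (a * x))).re ≤ 2 * (‖star a * a‖ + 1) * (f (star x * x)).re := by
  set c : ℝ := 2 * (‖star a * a‖ + 1) with hc
  have hc0 : 0 < c := by positivity
  have hsa : IsSelfAdjoint (((c⁻¹ : ℝ) : ℂ) • (star a * a)) := by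
    rw [isSelfAdjoint_iff, star_smul, star_mul, star_star]; simp
  obtain ⟨u, hu, hsq⟩ := hsa.exists_sq_eq_one_sub (by
    refine (norm_smul_le _ _).trans ?_
    rw [Complex.norm_real, Real.norm_of_nonneg (by positivity), inv_mul_le_iff₀ hc0]
    linarith)
  have h1 := (Complex.nonneg_iff.mp (hf (u * x))).1
  have h2 : star (u * x) * (u * x) =
      star x * x - ((c⁻¹ : ℝ) : ℂ) • (star (a * x) * (a * x)) := by
    calc star (u * x) * (u * x) = star x * (u * u) * x := by
          rw [star_mul, hu.star_eq]; noncomm_ring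
      _ = _ := by
          rw [hsq, mul_sub, sub_mul, mul_one, mul_smul_comm, smul_mul_assoc, star_mul]
          noncomm_ring
  rw [h2, map_sub, map_smul, Complex.sub_re, smul_eq_mul, Complex.re_ofReal_mul, sub_nonneg,
    inv_mul_le_iff₀ hc0] at h1
  exact h1

variable (hf : IsPositiveFunctional f)

theorem exists_bound_mul (a : 𝒜) :
    ∃ C : ℝ, ∀ x : hf.PreHilbert, ‖hf.toPreHilbert (a * hf.ofPreHilbert x)‖ ≤ C * ‖x‖ := by
  refine ⟨√(2 * (‖star a * a‖ + 1)), fun x => ?_⟩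
  rw [← sq_le_sq₀ (norm_nonneg _) (by positivity), mul_pow, Real.sq_sqrt (by positivity),
    norm_sq_preHilbert, norm_sq_preHilbert]
  exact hf.conj_mul_re_le a _

/-- Left multiplication by `a` on `PreHilbert`. -/
def leftMul (a : 𝒜) : hf.PreHilbert →L[ℂ] hf.PreHilbert :=
  (hf.toPreHilbert.toLinearMap ∘ₗ LinearMap.mulLeft ℂ a ∘ₗ
    hf.ofPreHilbert.toLinearMap).mkContinuousOfExistsBound (hf.exists_bound_mul a)

@[simp]
theorem leftMul_apply (a : 𝒜) (x : hf.PreHilbert) :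
    hf.leftMul a x = hf.toPreHilbert (a * hf.ofPreHilbert x) := rfl

theorem completion_leftMul_algebraMap (c : ℂ) :
    (hf.leftMul (algebraMap ℂ 𝒜 c)).completion = algebraMap ℂ _ c := by
  ext x
  induction x using UniformSpace.Completion.induction_on with
  | hp => apply isClosed_eq <;> fun_prop
  | ih x => simp [Algebra.algebraMap_eq_smul_one]

/-- The GNS representation of a positive functional on a unital Banach `*`-algebra. -/
def rep : 𝒜 →⋆ₐ[ℂ]
    (UniformSpace.Completion hf.PreHilbert →L[ℂ] UniformSpace.Completion hf.PreHilbert) where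
  toFun a := (hf.leftMul a).completion
  map_one' := by simpa using hf.completion_leftMul_algebraMap 1
  map_zero' := by simpa using hf.completion_leftMul_algebraMap 0
  commutes' := hf.completion_leftMul_algebraMap
  map_add' a b := by
    ext x
    induction x using UniformSpace.Completion.induction_on with
    | hp => apply isClosed_eq <;> fun_prop
    | ih x => simp [add_mul, UniformSpace.Completion.coe_add]
  map_mul' a b := by
    ext x
    induction x using UniformSpace.Completion.induction_on with
    | hp => apply isClosed_eq <;> fun_prop
    | ih x => simp [mul_assoc]
  map_star' a := by
    refine (ContinuousLinearMap.eq_adjoint_iff (hf.leftMul (star a)).completion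
      (hf.leftMul a).completion).mpr ?_
    intro x y
    induction x, y using UniformSpace.Completion.induction_on₂ with
    | hp => apply isClosed_eq <;> fun_prop
    | ih x y => simp [mul_assoc, inner_preHilbert]

theorem inner_rep (a : 𝒜) :
    ⟪(hf.toPreHilbert 1 : UniformSpace.Completion hf.PreHilbert),
      hf.rep a (hf.toPreHilbert 1 : UniformSpace.Completion hf.PreHilbert)⟫_ℂ = f a := by
  change ⟪_, (hf.leftMul a).completion _⟫_ℂ = _
  rw [ContinuousLinearMap.completion_apply_coe, UniformSpace.Completion.inner_coe,
    inner_preHilbert]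
  simp

/-- Positive functionals on a unital Banach `*`-algebra are representable. -/
theorem isRepresentable (hf : IsPositiveFunctional f) : IsRepresentable f :=
  ⟨UniformSpace.Completion hf.PreHilbert, inferInstance, inferInstance, inferInstance,
    (hf.rep : 𝒜 →⋆ₙₐ[ℂ] _), hf.toPreHilbert 1, fun a => (hf.inner_rep a).symm⟩

end IsPositiveFunctional

end

/-! ### Three circles estimate for the spectral radius. -/

section SpectralRadiusAffine

set_option linter.unusedSectionVars false

variable {B : Type*} [NormedRing B] [NormedAlgebra ℂ B] [CompleteSpace B]

/-- A bound for the spectral radius on a compact set yields a uniform bound for a power. -/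
theorem eventually_forall_norm_pow_two_pow_lt {K : Set ℂ} (hK : IsCompact K) {p : ℂ → B}
    (hp : Continuous p) {M : ℝ}
    (h : ∀ z ∈ K, spectralRadius ℂ (p z) < ENNReal.ofReal M) :
    ∀ᶠ k : ℕ in Filter.atTop, ∀ z ∈ K, ‖p z ^ 2 ^ k‖ < M ^ 2 ^ k := by
  -- Exponents `2 ^ k` are used because squaring preserves the bound; the open sets where it holds
  -- increase with `k`, and one of them covers `K`.
  have hmono : ∀ z, ∀ k l : ℕ, k ≤ l → ‖p z ^ 2 ^ k‖ < M ^ 2 ^ k → ‖p z ^ 2 ^ l‖ < M ^ 2 ^ l := by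
    intro z k l hkl hk
    induction l, hkl using Nat.le_induction with
    | base => exact hk
    | succ l _ ih =>
      rw [pow_succ 2 l, pow_mul, pow_mul, sq, sq]
      refine (norm_mul_le _ _).trans_lt ?_
      nlinarith [norm_nonneg (p z ^ 2 ^ l)]
  obtain ⟨k, hk⟩ := hK.elim_directed_cover (fun k : ℕ => {z | ‖p z ^ 2 ^ k‖ < M ^ 2 ^ k})
    (fun k => isOpen_lt (by fun_prop) (by fun_prop))
    (fun z hz => by
      obtain ⟨k, hk⟩ := ((tendsto_pow_atTop_atTop_of_one_lt (one_lt_two (α := ℕ))).eventually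
        (eventually_norm_pow_lt (h z hz))).exists
      exact Set.mem_iUnion.mpr ⟨k, hk⟩)
    (directed_of_isDirected_le fun k l hkl z hz => hmono z k l hkl hz)
  filter_upwards [Filter.eventually_ge_atTop k] with l hl z hz
  exact hmono z k l hl (hk hz)

/-- The maximum principle on an annulus, for `F z * F z⁻¹`. -/
theorem norm_mul_self_le_of_annulus {F : ℂ → B} (hF : Differentiable ℂ F) {R M N : ℝ} (hR : 1 < R)
    (hM : ∀ z, ‖z‖ = R → ‖F z‖ ≤ M) (hN : ∀ z, ‖z‖ = R⁻¹ → ‖F z‖ ≤ N) :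
    ‖F 1 * F 1‖ ≤ M * N := by
  have hR0 : 0 < R := one_pos.trans hR
  have hM0 : 0 ≤ M := (norm_nonneg _).trans (hM R (by simp [abs_of_pos hR0]))
  have hN0 : 0 ≤ N := (norm_nonneg _).trans (hN (R⁻¹ : ℝ) (by simp [abs_of_pos hR0]))
  let U : Set ℂ := {z | R⁻¹ < ‖z‖ ∧ ‖z‖ < R}
  have hUc : closure U ⊆ {z | R⁻¹ ≤ ‖z‖ ∧ ‖z‖ ≤ R} :=
    closure_minimal (fun z hz => ⟨hz.1.le, hz.2.le⟩)
      ((isClosed_le continuous_const continuous_norm).inter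
        (isClosed_le continuous_norm continuous_const))
  have hUo : IsOpen U :=
    (isOpen_lt continuous_const continuous_norm).inter (isOpen_lt continuous_norm continuous_const)
  have hb : Bornology.IsBounded U :=
    (Metric.isBounded_ball (x := (0 : ℂ)) (r := R)).subset fun z hz => by simpa using hz.2
  -- Inversion swaps the two boundary circles, so on each of them one factor is bounded by `M` and
  -- the other by `N`.
  have hd : DifferentiableOn ℂ (fun z => F z * F z⁻¹) (closure U) := by
    intro z hz
    have hz0 : z ≠ 0 := norm_pos_iff.mp ((inv_pos.mpr hR0).trans_le (hUc hz).1)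
    exact ((hF z).mul ((hF z⁻¹).comp z (differentiableAt_inv hz0))).differentiableWithinAt
  have h1 : (1 : ℂ) ∈ closure U := subset_closure ⟨by simpa using inv_lt_one_of_one_lt₀ hR, by simpa⟩
  have := Complex.norm_le_of_forall_mem_frontier_norm_le hb hd.diffContOnCl (C := M * N) ?_ h1
  · simpa using this
  · intro z hz
    have hzc := hUc hz.1
    have hzU : z ∉ U := by
      have := hz.2
      rwa [hUo.interior_eq] at this
    refine (norm_mul_le _ _).trans ?_
    rcases hzc.1.eq_or_lt with h | h
    · rw [mul_comm]
      exact mul_le_mul (hM _ (by rw [norm_inv, ← h, inv_inv])) (hN _ h.symm) (norm_nonneg _) hM0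
    · have h2 : ‖z‖ = R := by
        by_contra h3
        exact hzU ⟨h, lt_of_le_of_ne hzc.2 h3⟩
      exact mul_le_mul (hM _ h2) (hN _ (by rw [norm_inv, h2])) (norm_nonneg _) hM0

/-- Ransford's three circles estimate for the spectral radius of an affine function. -/
theorem spectralRadius_sq_le_of_annulus (x y : B) {R M N : ℝ} (hR : 1 < R)
    (hM : ∀ z : ℂ, ‖z‖ = R → spectralRadius ℂ (z • x + y) < ENNReal.ofReal M)
    (hN : ∀ z : ℂ, ‖z‖ = R⁻¹ → spectralRadius ℂ (z • x + y) < ENNReal.ofReal N) :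
    spectralRadius ℂ (x + y) ^ 2 ≤ ENNReal.ofReal (M * N) := by
  have hR0 : 0 < R := one_pos.trans hR
  have hM0 : 0 < M := ENNReal.ofReal_pos.mp (bot_le.trans_lt (hM R (by simp [abs_of_pos hR0])))
  have hN0 : 0 < N :=
    ENNReal.ofReal_pos.mp (bot_le.trans_lt (hN (R⁻¹ : ℝ) (by simp [abs_of_pos hR0])))
  have hp : Continuous fun z : ℂ => z • x + y := by fun_prop
  have e1 := eventually_forall_norm_pow_two_pow_lt (isCompact_sphere (0 : ℂ) R) hp
    (fun z hz => hM z (by simpa using hz))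
  have e2 := eventually_forall_norm_pow_two_pow_lt (isCompact_sphere (0 : ℂ) R⁻¹) hp
    (fun z hz => hN z (by simpa using hz))
  obtain ⟨k, h1, h2⟩ := (e1.and e2).exists
  have h3 := norm_mul_self_le_of_annulus (F := fun z : ℂ => (z • x + y) ^ 2 ^ k)
    (by fun_prop) hR (fun z hz => (h1 z (by simpa using hz)).le)
    (fun z hz => (h2 z (by simpa using hz)).le)
  have hk : (2 ^ k : ℕ) ≠ 0 := by positivity
  -- `F 1 * F 1 = (x + y) ^ (2 * 2 ^ k)`; the `2 ^ k`-th root removes the dependence on `k`.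
  have h4 : spectralRadius ℂ (x + y) ^ (2 * 2 ^ k) ≤ ENNReal.ofReal (M * N) ^ 2 ^ k := by
    refine (spectrum.spectralRadius_pow_le _ _ (by positivity)).trans
      ((spectralRadius_le_nnnorm_of_complete _).trans ?_)
    rw [← ENNReal.ofReal_pow (by positivity), ← ENNReal.ofReal_coe_nnreal]
    refine ENNReal.ofReal_le_ofReal ?_
    rw [two_mul, pow_add, mul_pow]
    simpa using h3
  rw [pow_mul] at h4
  exact (ENNReal.pow_le_pow_left_iff hk).mp h4

end SpectralRadiusAffine

/-! ### Automatic continuity of `*`-homomorphisms. -/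

namespace StarAlgHom

set_option linter.unusedSectionVars false

variable {A B : Type*} [NormedRing A] [NormedAlgebra ℂ A] [CompleteSpace A] [StarRing A]
  [StarModule ℂ A] [CStarAlgebra B] (π : A →⋆ₐ[ℂ] B)

theorem spectralRadius_map_le_nnnorm (a : A) : spectralRadius ℂ (π a) ≤ ‖a‖₊ :=
  (biSup_mono fun _ hz => AlgHom.spectrum_apply_subset π a hz).trans
    (spectralRadius_le_nnnorm_of_complete a)

theorem spectralRadius_map_star_le_nnnorm (a : A) : spectralRadius ℂ (π (star a)) ≤ ‖a‖₊ := by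
  rw [map_star, spectralRadius_star_eq]
  exact π.spectralRadius_map_le_nnnorm a

/-- The affine function `z • π (y n) + π (b - y n)` equals `π b` at `z = 1`. On `‖z‖ = R` it is the
image of the star of an element of norm at most `R ‖x n‖ + ‖star b - x n‖`; on `‖z‖ = R⁻¹` the bound
is `R⁻¹ ‖y n‖ + ‖b - y n‖`. The three circles estimate, then `n → ∞`, then `R → ∞`, gives zero. -/
theorem spectralRadius_map_eq_zero_of_tendsto {x y : ℕ → A} {b : A}
    (hx : Filter.Tendsto x Filter.atTop (nhds 0)) (hy : Filter.Tendsto y Filter.atTop (nhds b))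
    (h : ∀ n, π (y n) = π (star (x n))) : spectralRadius ℂ (π b) = 0 := by
  have hlt : ∀ (w : B) (u : A) (t s : ℝ), spectralRadius ℂ w ≤ ‖u‖₊ → ‖u‖ ≤ t → 0 < s →
      spectralRadius ℂ w < ENNReal.ofReal (t + s) := by
    intro w u t s hw hu hs
    refine hw.trans_lt ?_
    rw [← ENNReal.ofReal_coe_nnreal, coe_nnnorm]
    exact (ENNReal.ofReal_lt_ofReal_iff (by linarith [norm_nonneg u])).mpr (by linarith)
  -- The extra `R⁻¹` in each factor makes the bounds strict and vanishes in the limit.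
  have key : ∀ R : ℝ, 1 < R → ∀ n, spectralRadius ℂ (π b) ^ 2 ≤ ENNReal.ofReal
      ((R * ‖x n‖ + ‖star b - x n‖ + R⁻¹) * (R⁻¹ * ‖y n‖ + ‖b - y n‖ + R⁻¹)) := by
    intro R hR n
    have hR0 : 0 < R := one_pos.trans hR
    have h0 : π b = π (y n) + π (b - y n) := by rw [← map_add, add_sub_cancel]
    rw [h0]
    refine spectralRadius_sq_le_of_annulus _ _ hR (fun z hz => ?_) (fun z hz => ?_)
    · refine hlt _ (starRingEnd ℂ z • x n + (star b - x n)) _ _ ?_ ?_ (inv_pos.mpr hR0)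
      · refine le_of_eq_of_le ?_ (π.spectralRadius_map_star_le_nnnorm _)
        simp [star_add, star_smul, h]
      · refine (norm_add_le _ _).trans ?_
        gcongr
        exact (norm_smul_le _ _).trans_eq (by simp [hz])
    · refine hlt _ (z • y n + (b - y n)) _ _ ?_ ?_ (inv_pos.mpr hR0)
      · refine le_of_eq_of_le ?_ (π.spectralRadius_map_le_nnnorm _)
        simp
      · refine (norm_add_le _ _).trans ?_
        gcongr
        exact (norm_smul_le _ _).trans_eq (by rw [hz])
  have key2 : ∀ R : ℝ, 1 < R → spectralRadius ℂ (π b) ^ 2 ≤ ENNReal.ofReal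
      ((R * ‖(0 : A)‖ + ‖star b - 0‖ + R⁻¹) * (R⁻¹ * ‖b‖ + ‖b - b‖ + R⁻¹)) := by
    intro R hR
    refine ge_of_tendsto' (x := (Filter.atTop : Filter ℕ)) (ENNReal.tendsto_ofReal ?_) (key R hR)
    exact (((hx.norm.const_mul R).add (tendsto_const_nhds.sub hx).norm).add_const _).mul
      (((hy.norm.const_mul R⁻¹).add (tendsto_const_nhds.sub hy).norm).add_const _)
  have hinv := tendsto_inv_atTop_zero (𝕜 := ℝ)
  have key3 : spectralRadius ℂ (π b) ^ 2 ≤ ENNReal.ofReal ((‖star b‖ + 0) * (0 * ‖b‖ + 0)) := by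
    refine ge_of_tendsto (ENNReal.tendsto_ofReal (((tendsto_const_nhds (x := ‖star b‖)).add
      hinv).mul ((hinv.mul_const ‖b‖).add hinv))) ?_
    filter_upwards [Filter.eventually_gt_atTop 1] with R hR
    simpa using key2 R hR
  simpa using key3

/-- The involution has closed graph modulo the kernel of a `*`-representation. -/
theorem map_eq_zero_of_tendsto {x y : ℕ → A} {b : A}
    (hx : Filter.Tendsto x Filter.atTop (nhds 0)) (hy : Filter.Tendsto y Filter.atTop (nhds b))
    (h : ∀ n, π (y n) = π (star (x n))) : π b = 0 := by
  -- Passing to `star b * b` makes the image self-adjoint, where spectral radius zero forces `‖π b‖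
  -- ^ 2 = 0`.
  have h1 : spectralRadius ℂ (π (star b * b)) = 0 := by
    refine π.spectralRadius_map_eq_zero_of_tendsto (x := fun n => x n * b)
      (y := fun n => star b * y n) ?_ (hy.const_mul _) fun n => ?_
    · simpa using hx.mul_const b
    · rw [star_mul, map_mul, map_mul, h]
  rw [map_mul, map_star] at h1
  have h2 := CStarAlgebra.toReal_spectralRadius_star_mul_self_eq_norm_sq (π b)
  rw [h1] at h2
  simpa using h2.symm

/-- The pairs `(a, b)` such that `π b` is the adjoint of `π a`. -/
def starGraph : Submodule ℝ (A × A) where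
  carrier := {p | π p.2 = star (π p.1)}
  add_mem' := by
    rintro p q (hp : _ = _) (hq : _ = _)
    simp [hp, hq]
  zero_mem' := by simp
  smul_mem' := by
    rintro c p (hp : _ = _)
    have h1 : ∀ a : A, π (c • a) = (c : ℂ) • π a := fun a => by
      rw [← map_smul]; rfl
    simp [h1, hp]

theorem mem_starGraph {p : A × A} : p ∈ π.starGraph ↔ π p.2 = star (π p.1) := Iff.rfl

/-- If `(a_n, b_n) → (a, b)` in the graph, the previous result applies to `a_n - a → 0` and `b_n -
a^* → b - a^*`. -/
theorem isClosed_starGraph : IsClosed (π.starGraph : Set (A × A)) := by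
  refine IsSeqClosed.isClosed fun p q hp hpq => ?_
  have h1 := ((continuous_fst.tendsto q).comp hpq).sub_const q.1
  have h2 := ((continuous_snd.tendsto q).comp hpq).sub_const (star q.1)
  rw [sub_self] at h1
  have h3 := π.map_eq_zero_of_tendsto h1 h2 fun n => by
    simp [(π.mem_starGraph).mp (hp n), map_star]
  rw [map_sub, map_star, sub_eq_zero] at h3
  exact h3

/-- A `*`-homomorphism from a Banach `*`-algebra, whose involution need not be continuous, to a
C⋆-algebra is bounded. -/
theorem exists_norm_map_le : ∃ C : ℝ, ∀ a : A, ‖π a‖ ≤ C * ‖a‖ := by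
  have : CompleteSpace π.starGraph := π.isClosed_starGraph.completeSpace_coe
  let F : π.starGraph →L[ℝ] A := (ContinuousLinearMap.fst ℝ A A).comp π.starGraph.subtypeL
  -- Open mapping: each `a` has a partner `b` with `π b = star (π a)` and `‖b‖ ≤ C ‖a‖`, a
  -- norm-controlled substitute for `star a`. Then `‖π a‖ ^ 2` is the spectral radius of `π (b *
  -- a)`, hence at most `‖b * a‖`.
  obtain ⟨C, hC, hF⟩ := F.exists_preimage_norm_le fun a =>
    ⟨⟨(a, star a), by rw [mem_starGraph, map_star]⟩, rfl⟩
  refine ⟨√C, fun a => ?_⟩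
  obtain ⟨⟨⟨a', b⟩, hb⟩, rfl, hle⟩ := hF a
  have hb' : ‖b‖ ≤ C * ‖a'‖ := (norm_snd_le (a', b)).trans hle
  change ‖π a'‖ ≤ √C * ‖a'‖
  have h1 : ‖π a'‖ ^ 2 ≤ ‖b * a'‖ := by
    rw [← CStarAlgebra.toReal_spectralRadius_star_mul_self_eq_norm_sq, ← (π.mem_starGraph).mp hb,
      ← map_mul]
    exact ENNReal.toReal_mono ENNReal.coe_ne_top (π.spectralRadius_map_le_nnnorm (b * a'))
  rw [← sq_le_sq₀ (norm_nonneg _) (by positivity), mul_pow, Real.sq_sqrt hC.le]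
  have h2 := norm_mul_le b a'
  nlinarith [norm_nonneg a']

end StarAlgHom

/-! ### The positive operator of a positive functional. -/

noncomputable section

namespace IsPositiveFunctional

variable {𝒜 : Type u} [NormedRing 𝒜] [NormedAlgebra ℂ 𝒜] [CompleteSpace 𝒜] [StarRing 𝒜]
  [StarModule ℂ 𝒜] {f : 𝒜 →ₗ[ℂ] ℂ}

/-- `f (b^* a)` is the inner product of `π(a) ζ` and `π(b) ζ` with `ζ = [1]`, and the GNS
representation `π` is norm bounded by automatic continuity. -/
theorem exists_norm_apply_star_mul_le (hf : IsPositiveFunctional f) :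
    ∃ C : ℝ, ∀ a b : 𝒜, ‖f (star b * a)‖ ≤ C * ‖a‖ * ‖b‖ := by
  obtain ⟨C, hC⟩ := hf.rep.exists_norm_map_le
  let ζ : UniformSpace.Completion hf.PreHilbert := ((hf.toPreHilbert 1 : hf.PreHilbert) : _)
  have hb : ∀ a, ‖hf.rep a ζ‖ ≤ C * ‖a‖ * ‖ζ‖ := fun a =>
    ((hf.rep a).le_opNorm ζ).trans (by gcongr; exact hC a)
  refine ⟨C * ‖ζ‖ * (C * ‖ζ‖), fun a b => ?_⟩
  rw [← hf.inner_rep, map_mul, map_star, ContinuousLinearMap.star_eq_adjoint,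
    ContinuousLinearMap.mul_def, ContinuousLinearMap.comp_apply,
    ContinuousLinearMap.adjoint_inner_right]
  calc _ ≤ ‖hf.rep b ζ‖ * ‖hf.rep a ζ‖ := norm_inner_le_norm _ _
    _ ≤ (C * ‖b‖ * ‖ζ‖) * (C * ‖a‖ * ‖ζ‖) := by
        gcongr
        · exact (norm_nonneg _).trans (hb b)
        · exact hb b
        · exact hb a
    _ = _ := by ring

/-- The positive operator `⟨A a, b⟩ = f (b^* a)` of a positive functional `f`. -/
def positiveOperator (hf : IsPositiveFunctional f) : PositiveOperator 𝒜 where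
  toCLM := LinearMap.mkContinuous₂ (σ₁₃ := RingHom.id ℂ) (σ₂₃ := starRingEnd ℂ)
    { toFun := fun a =>
        { toFun := fun b => f (star b * a)
          map_add' := fun b c => by simp [add_mul]
          map_smul' := fun c b => by simp }
      map_add' := fun a b => by ext c; simp [mul_add]
      map_smul' := fun c a => by ext b; simp }
    hf.exists_norm_apply_star_mul_le.choose hf.exists_norm_apply_star_mul_le.choose_spec
  nonneg' := hf

theorem positiveOperator_apply (hf : IsPositiveFunctional f) (a b : 𝒜) :
    hf.positiveOperator.toCLM a b = f (star b * a) := rfl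

end IsPositiveFunctional

/-! ### Projections onto orthogonal complements. -/

section Projection

variable {H H' : Type u} [NormedAddCommGroup H] [InnerProductSpace ℂ H] [CompleteSpace H]
  [NormedAddCommGroup H'] [InnerProductSpace ℂ H'] [CompleteSpace H']

theorem projOrthogonal_mem (K : Submodule ℂ H) (u : H) : projOrthogonal K u ∈ Kᗮ :=
  Submodule.starProjection_apply_mem _ _

theorem sub_projOrthogonal_mem (K : Submodule ℂ H) (u : H) :
    u - projOrthogonal K u ∈ K.topologicalClosure := by
  rw [← Submodule.orthogonal_orthogonal_eq_closure]
  exact Submodule.sub_starProjection_mem_orthogonal u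

theorem projOrthogonal_eq_of_mem {K : Submodule ℂ H} {u v : H} (hv : v ∈ Kᗮ)
    (huv : u - v ∈ K.topologicalClosure) : projOrthogonal K u = v :=
  Submodule.eq_starProjection_of_mem_orthogonal hv
    (by rwa [Submodule.orthogonal_orthogonal_eq_closure])

theorem projOrthogonal_topologicalClosure (K : Submodule ℂ H) :
    projOrthogonal K.topologicalClosure = projOrthogonal K := by
  ext u
  refine projOrthogonal_eq_of_mem ?_ ?_
  · rw [Submodule.orthogonal_closure]
    exact projOrthogonal_mem K u
  · exact Submodule.le_topologicalClosure _ (sub_projOrthogonal_mem K u)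

/-- An isometry intertwines the projections onto the orthogonal complements of a subspace and of
its image. -/
theorem projOrthogonal_map (W : H →ₗᵢ[ℂ] H') (K : Submodule ℂ H) (u : H) :
    projOrthogonal (K.map W.toLinearMap) (W u) = W (projOrthogonal K u) := by
  refine projOrthogonal_eq_of_mem ?_ ?_
  · rw [Submodule.mem_orthogonal]
    rintro _ ⟨k, hk, rfl⟩
    change ⟪W k, W _⟫_ℂ = 0
    rw [W.inner_map_map]
    exact Submodule.inner_right_of_mem_orthogonal hk (projOrthogonal_mem K u)
  · rw [← map_sub]
    have h1 : W (u - projOrthogonal K u) ∈ closure (W '' (K : Set H)) :=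
      image_closure_subset_closure_image W.continuous ⟨_, sub_projOrthogonal_mem K u, rfl⟩
    exact h1

end Projection

/-! ### The adjoints in the operator parallel sum. -/

namespace PositiveOperator

variable {E : Type u} [NormedAddCommGroup E] [NormedSpace ℂ E] (A B : PositiveOperator E)

/-- Reproducing property: it holds on `ran A` by definition and extends by density. It identifies
`J_A^* (j_E x)` with `A x`. -/
theorem embedding_apply (h : A.HilbertSpace) (x : E) :
    A.embedding h x = ⟪(A.toRan x : A.HilbertSpace), h⟫_ℂ := by
  induction h using UniformSpace.Completion.induction_on with
  | hp => apply isClosed_eq <;> fun_prop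
  | ih v =>
    rw [UniformSpace.Completion.inner_coe, inner_toRan, embedding,
      ContinuousLinearMap.fromCompletion_apply_coe]
    rfl

theorem antiAdjoint_embeddingLeft (x : E) :
    antiAdjoint (embeddingLeft A B) (antiBidualEmbedding E x) =
      WithLp.toLp 2 ((A.toRan x : A.HilbertSpace), (0 : B.HilbertSpace)) := by
  refine ext_inner_left ℂ fun h => ?_
  rw [inner_antiAdjoint, antiBidualEmbedding_apply]
  change starRingEnd ℂ (A.embedding h.fst x) = _
  rw [embedding_apply, inner_conj_symm, WithLp.prod_inner_apply]
  simp

theorem antiAdjoint_embeddingSum (x : E) :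
    antiAdjoint (embeddingSum A B) (antiBidualEmbedding E x) =
      WithLp.toLp 2 ((A.toRan x : A.HilbertSpace), (B.toRan x : B.HilbertSpace)) := by
  refine ext_inner_left ℂ fun h => ?_
  rw [inner_antiAdjoint, antiBidualEmbedding_apply]
  change starRingEnd ℂ (A.embedding h.fst x + B.embedding h.snd x) = _
  rw [map_add, embedding_apply, embedding_apply, inner_conj_symm, inner_conj_symm,
    WithLp.prod_inner_apply]
  rfl

theorem conj_parallelSum_apply (x y : E) :
    starRingEnd ℂ ((A.parallelSum B).toCLM x y) =
      ⟪proj A B (WithLp.toLp 2 ((A.toRan x : A.HilbertSpace), (0 : B.HilbertSpace))),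
        WithLp.toLp 2 ((A.toRan y : A.HilbertSpace), (0 : B.HilbertSpace))⟫_ℂ := by
  rw [← antiAdjoint_embeddingLeft, ← antiAdjoint_embeddingLeft, inner_antiAdjoint,
    antiBidualEmbedding_apply]
  rfl

end PositiveOperator

/-! ### Comparison of the two parallel sums. -/

namespace RepresentableFunctional

section General

variable {𝒜 : Type u} [NonUnitalRing 𝒜] [StarRing 𝒜] [Module ℂ 𝒜] [IsScalarTower ℂ 𝒜 𝒜]
  [SMulCommClass ℂ 𝒜 𝒜] [StarModule ℂ 𝒜] (f g : RepresentableFunctional 𝒜)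

/-- The diagonal is invariant under `π(a^*) = π(a)^*`, so its complement is invariant under `π(a)`.
-/
theorem gnsRepSum_mem_orthogonal (a : 𝒜) {y : GNSSum f g} (hy : y ∈ (gnsDiagonal f g)ᗮ) :
    gnsRepSum f g a y ∈ (gnsDiagonal f g)ᗮ := by
  rw [Submodule.mem_orthogonal]
  rintro _ ⟨b, rfl⟩
  rw [← ContinuousLinearMap.adjoint_inner_left, ← ContinuousLinearMap.star_eq_adjoint, ← map_star]
  refine Submodule.inner_right_of_mem_orthogonal (K := gnsDiagonal f g) ?_ hy
  refine ⟨star a * b, ?_⟩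
  change _ = directSumOp _ _ _
  simp

/-- The second projection can be dropped: `π(a^*) Q z` lies in the complement, hence is orthogonal
to `z - Q z`. -/
theorem parallelSum_apply (a : 𝒜) :
    (parallelSum f g).toLinearMap a = ⟪projOrthogonal (gnsDiagonal f g)
      (WithLp.toLp 2 (f.gnsVector, 0)), gnsRepSum f g a (WithLp.toLp 2 (f.gnsVector, 0))⟫_ℂ := by
  change ⟪parallelVector f g, gnsRepSum f g a (parallelVector f g)⟫_ℂ = _
  rw [parallelVector, projOrthogonal_topologicalClosure]
  set z : GNSSum f g := WithLp.toLp 2 (f.gnsVector, 0)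
  have h1 := gnsRepSum_mem_orthogonal f g (star a) (projOrthogonal_mem (gnsDiagonal f g) z)
  rw [← Submodule.orthogonal_closure] at h1
  have h2 := Submodule.inner_left_of_mem_orthogonal (sub_projOrthogonal_mem _ z) h1
  rw [map_star, ContinuousLinearMap.star_eq_adjoint, ContinuousLinearMap.adjoint_inner_left,
    map_sub, inner_sub_right, sub_eq_zero] at h2
  exact h2.symm

end General

variable {𝒜 : Type u} [NormedRing 𝒜] [NormedAlgebra ℂ 𝒜] [StarRing 𝒜] [StarModule ℂ 𝒜]
  (f g : RepresentableFunctional 𝒜) (A B : PositiveOperator 𝒜)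

theorem gnsVector_eq : f.gnsVector = (f.toPreGNS 1 : f.GNS) := by
  refine ext_inner_right ℂ fun y => ?_
  induction y using UniformSpace.Completion.induction_on with
  | hp => apply isClosed_eq <;> fun_prop
  | ih y =>
    rw [UniformSpace.Completion.inner_coe, inner_preGNS, ← f.toPreGNS_ofPreGNS y, inner_gnsVector]
    simp

variable {f g A B}

/-- The isometry `[a] ↦ A a` of `𝒜` with the semi-inner product `(· | ·)_f` into `ran A`. -/
def preGNSIsometry (hA : ∀ a b, A.toCLM a b = f.toLinearMap (star b * a)) :
    f.PreGNS →ₗᵢ[ℂ] A.Ran :=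
  LinearMap.isometryOfInner (A.toRan ∘ₗ f.ofPreGNS.toLinearMap) fun x y => by
    change ⟪A.toRan (f.ofPreGNS x), A.toRan (f.ofPreGNS y)⟫_ℂ = _
    rw [A.inner_toRan, A.ranSubtype_toRan, hA, inner_preGNS]

/-- The isometry `[a] ↦ A a` of `H_f` into `H_A`, where `⟨A a, b⟩ = f (b^* a)`. -/
def gnsIsometry (hA : ∀ a b, A.toCLM a b = f.toLinearMap (star b * a)) :
    f.GNS →ₗᵢ[ℂ] A.HilbertSpace :=
  LinearMap.isometryOfInner
    (preGNSIsometry hA).toContinuousLinearMap.completion.toLinearMap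
    fun x y => by
      induction x, y using UniformSpace.Completion.induction_on₂ with
      | hp => apply isClosed_eq <;> fun_prop
      | ih x y => simp

theorem gnsIsometry_coe (hA : ∀ a b, A.toCLM a b = f.toLinearMap (star b * a)) (a : 𝒜) :
    gnsIsometry hA (f.toPreGNS a : f.GNS) = (A.toRan a : A.HilbertSpace) :=
  ContinuousLinearMap.completion_apply_coe _ _

/-- The isometry `([a], [b]) ↦ (A a, B b)` of `H_f ⊕ H_g` into `H_A × H_B`. -/
def gnsSumIsometry (hA : ∀ a b, A.toCLM a b = f.toLinearMap (star b * a))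
    (hB : ∀ a b, B.toCLM a b = g.toLinearMap (star b * a)) :
    GNSSum f g →ₗᵢ[ℂ] PositiveOperator.ProdSpace A B :=
  LinearMap.isometryOfInner
    { toFun := fun u => WithLp.toLp 2 (gnsIsometry hA u.fst, gnsIsometry hB u.snd)
      map_add' := fun u v => by simp [← WithLp.toLp_add]
      map_smul' := fun c u => by simp [← WithLp.toLp_smul] }
    fun u v => by
      change ⟪WithLp.toLp 2 (gnsIsometry hA u.fst, gnsIsometry hB u.snd),
        WithLp.toLp 2 (gnsIsometry hA v.fst, gnsIsometry hB v.snd)⟫_ℂ = _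
      simp

theorem gnsSumIsometry_toLp (hA : ∀ a b, A.toCLM a b = f.toLinearMap (star b * a))
    (hB : ∀ a b, B.toCLM a b = g.toLinearMap (star b * a)) (h : f.GNS) (k : g.GNS) :
    gnsSumIsometry hA hB (WithLp.toLp 2 (h, k)) =
      WithLp.toLp 2 (gnsIsometry hA h, gnsIsometry hB k) := rfl

theorem map_gnsDiagonal (hA : ∀ a b, A.toCLM a b = f.toLinearMap (star b * a))
    (hB : ∀ a b, B.toCLM a b = g.toLinearMap (star b * a)) :
    (gnsDiagonal f g).map (gnsSumIsometry hA hB).toLinearMap =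
      LinearMap.range ((antiAdjoint (PositiveOperator.embeddingSum A B)).comp
        (antiBidualEmbedding 𝒜)).toLinearMap := by
  have key : ∀ a : 𝒜, gnsSumIsometry hA hB
      (WithLp.toLp 2 (f.gnsRep a f.gnsVector, g.gnsRep a g.gnsVector)) =
      antiAdjoint (PositiveOperator.embeddingSum A B) (antiBidualEmbedding 𝒜 a) := fun a => by
    rw [PositiveOperator.antiAdjoint_embeddingSum, gnsSumIsometry_toLp, gnsRep_gnsVector,
      gnsRep_gnsVector, gnsIsometry_coe, gnsIsometry_coe]
  ext v
  constructor
  · rintro ⟨_, ⟨a, rfl⟩, rfl⟩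
    exact ⟨a, (key a).symm⟩
  · rintro ⟨a, rfl⟩
    exact ⟨_, ⟨a, rfl⟩, key a⟩

/-- The parallel sum of functionals corresponds to the parallel sum of operators. -/
theorem parallelSum_eq_conj (hA : ∀ a b, A.toCLM a b = f.toLinearMap (star b * a))
    (hB : ∀ a b, B.toCLM a b = g.toLinearMap (star b * a)) (a : 𝒜) :
    (parallelSum f g).toLinearMap a = starRingEnd ℂ ((A.parallelSum B).toCLM 1 a) := by
  -- `(A b, 0)` is `J̃_A^* (j_E b)`, and `π(b)(ζ_f ⊕ 0) = ([b], 0)`.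
  have h1 : ∀ b : 𝒜, WithLp.toLp 2 ((A.toRan b : A.HilbertSpace), (0 : B.HilbertSpace)) =
      gnsSumIsometry hA hB (gnsRepSum f g b (WithLp.toLp 2 (f.gnsVector, 0))) := by
    intro b
    change _ = gnsSumIsometry hA hB (directSumOp (f.gnsRep b) (g.gnsRep b) _)
    simp [gnsSumIsometry_toLp, gnsRep_gnsVector, gnsIsometry_coe]
  have h2 : WithLp.toLp 2 ((A.toRan 1 : A.HilbertSpace), (0 : B.HilbertSpace)) =
      gnsSumIsometry hA hB (WithLp.toLp 2 (f.gnsVector, 0)) := by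
    rw [gnsSumIsometry_toLp, map_zero, gnsVector_eq, gnsIsometry_coe]
  rw [PositiveOperator.conj_parallelSum_apply, h1 a, h2, PositiveOperator.proj,
    ← map_gnsDiagonal hA hB, projOrthogonal_map, LinearIsometry.inner_map_map, parallelSum_apply]

end RepresentableFunctional

end

theorem theorem5p4 {𝒜 : Type u} [NormedRing 𝒜] [NormedAlgebra ℂ 𝒜] [CompleteSpace 𝒜]
    [StarRing 𝒜] [StarModule ℂ 𝒜] (f g : 𝒜 →ₗ[ℂ] ℂ)
    (hf : IsPositiveFunctional f) (hg : IsPositiveFunctional g) :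
    ∃ (hf' : IsRepresentable f) (hg' : IsRepresentable g) (A B : PositiveOperator 𝒜),
      (∀ a b : 𝒜, A.toCLM a b = f (star b * a)) ∧
      (∀ a b : 𝒜, B.toCLM a b = g (star b * a)) ∧
      ∀ a : 𝒜, (RepresentableFunctional.parallelSum ⟨f, hf'⟩ ⟨g, hg'⟩).toLinearMap a =
        starRingEnd ℂ ((A.parallelSum B).toCLM 1 a) :=
  ⟨hf.isRepresentable, hg.isRepresentable, hf.positiveOperator, hg.positiveOperator,
    hf.positiveOperator_apply, hg.positiveOperator_apply,
    RepresentableFunctional.parallelSum_eq_conj hf.positiveOperator_apply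
      hg.positiveOperator_apply⟩
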